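/- Let $\alpha,\lambda,x_0>0$ and let $W$ be a non-negative random variable with $\mathbb P(W>x)=\lambda x^{-\alpha}$ for all $x\ge x_0$. For integers $m\ge 2$ and $n\ge1$, let $\mathcal H_m(n,\alpha)$ be the random $m$-uniform hypergraph on the vertex set $\{1,\dots,n\}$ obtained as follows: the vertices carry i.i.d. weights $W_1,\dots,W_n$ distributed as $W$ and, given the weights, the $m$-element subsets of $\{1,\dots,n\}$ are hyperedges independently of each other, the subset $\{i_1,\dots,i_m\}$ with probability $\frac{W_{i_1}\cdots W_{i_m}}{n+W_{i_1}\cdots W_{i_m}}$. Let $\mathcal E_m$ be the number of hyperedges of $\mathcal H_m(n,\alpha)$. Then, as $n\to\infty$ with $m$ fixed, where $o_p(1)$ denotes a quantity that tends to $0$ in probability: 1. If $\alpha>1$, then $\mathbb E(W)<\infty$ and, for every integer $m\ge2$, $\mathcal E_m=(1+o_p(1))\,\frac{[\mathbb E(W)]^m}{m!}\,n^{m-1}$. 2. If $\alpha=1$, then for each $m\in\{2,3,4\}$ there is a constant $c>0$, depending only on $m$ and the distribution of $W$, such that $\mathcal E_m=(1+o_p(1))\,c\,n^{m-1}(\log n)^m$.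 3. If $\alpha<1$, then for each $m\in\{2,3,4\}$, $\mathcal E_m=(1+o_p(1))\,\frac{\pi\alpha^m\lambda^m}{\sin(\alpha\pi)\,m!\,(m-1)!}\,n^{m-\alpha}(\log n)^{m-1}$. -/

import Mathlib

open MeasureTheory ProbabilityTheory Filter Topology

universe u

/-- The probability measure `ν` is the law of a non-negative random variable `W` with
`ℙ(W > x) = lam * x ^ (-α)` for all `x ≥ x₀`. -/
structure IsPowerLaw (α lam x₀ : ℝ) (ν : Measure ℝ) : Prop where
  isProbabilityMeasure : IsProbabilityMeasure ν
  nonneg : ∀ᵐ x ∂ν, 0 ≤ x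
  tail : ∀ x : ℝ, x₀ ≤ x → ν.real (Set.Ioi x) = lam * x ^ (-α)

/-- The conditional probability of a hyperedge `e` on `n` vertices with weights `w`. -/
noncomputable def edgeProb {n : ℕ} (w : Fin n → ℝ) (e : Finset (Fin n)) : ℝ :=
  (∏ i ∈ e, w i) / ((n : ℝ) + ∏ i ∈ e, w i)

/-- The random `m`-uniform hypergraph on `n` vertices with independent weights of law `ν`: an
arbitrary probability space carrying i.i.d. weights of law `ν` and a random set of `m`-element
subsets of the vertex set such that, given the weights, the `m`-subsets `e` are hyperedges
independently of each other, each with probability `edgeProb w e`. -/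
structure RandomHypergraph (ν : Measure ℝ) (m n : ℕ) where
  /-- The underlying probability space. -/
  Ω : Type u
  [measurableSpace : MeasurableSpace Ω]
  /-- The probability on `Ω`. -/
  P : Measure Ω
  [isProbabilityMeasure : IsProbabilityMeasure P]
  /-- The vertex weights. -/
  weight : Ω → Fin n → ℝ
  /-- The set of hyperedges. -/
  edges : Ω → Finset (Finset (Fin n))
  measurable_weight : Measurable weight
  map_weight : ∀ i, Measure.map (fun ω => weight ω i) P = ν
  indep_weight : iIndepFun (fun i ω => weight ω i) P
  uniform : ∀ ω, ∀ e ∈ edges ω, e.card = m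
  measurableSet_edge : ∀ e, MeasurableSet {ω | e ∈ edges ω}
  condProb_edge : ∀ e : Finset (Fin n), e.card = m →
    P⟦{ω | e ∈ edges ω} | MeasurableSpace.comap weight inferInstance⟧
      =ᵐ[P] fun ω => edgeProb (weight ω) e
  condIndep_edge : ∀ S : Finset (Finset (Fin n)), (∀ e ∈ S, e.card = m) →
    P⟦⋂ e ∈ S, {ω | e ∈ edges ω} | MeasurableSpace.comap weight inferInstance⟧
      =ᵐ[P] fun ω => ∏ e ∈ S,
        (P⟦{ω' | e ∈ edges ω'} | MeasurableSpace.comap weight inferInstance⟧) ω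

attribute [instance] RandomHypergraph.measurableSpace RandomHypergraph.isProbabilityMeasure

/-- The number of hyperedges. -/
def RandomHypergraph.numEdges {ν : Measure ℝ} {m n : ℕ} (G : RandomHypergraph.{u} ν m n)
    (ω : G.Ω) : ℕ :=
  (G.edges ω).card

/-- `𝓔_m = (1 + o_p(1)) a_n` as `n → ∞`, for a sequence `G n` of random `m`-uniform hypergraphs
on `n` vertices: for all large `n` the number of hyperedges is `(1 + δ n) * a n`, where `δ n`
tends to zero in probability. -/
def NumEdgesAsymp {ν : Measure ℝ} {m : ℕ} (G : ∀ n : ℕ, RandomHypergraph.{u} ν m n)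
    (a : ℕ → ℝ) : Prop :=
  ∃ δ : ∀ n : ℕ, (G n).Ω → ℝ,
    (∀ᶠ n in atTop, ∀ ω, ((G n).numEdges ω : ℝ) = (1 + δ n ω) * a n) ∧
    ∀ ε : ℝ, 0 < ε → Tendsto (fun n => (G n).P {ω | ε ≤ |δ n ω|}) atTop (𝓝 0)

/-! The proof is a second moment computation. Let `X` be a product of `m` independent weights. The
unconditional probability of a hyperedge is `p = E[sat (X / n)]`, which is `meanSat ν m n⁻¹`, so the
mean number of hyperedges is `p` times a binomial coefficient. Disjoint `m`-subsets depend on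
disjoint sets of weights, hence are uncorrelated. Intersecting pairs form only an `O(1/n)` fraction
of all pairs, and distinct ones have joint probability at most `r = E[sat (X / n) ^ 2]`.
Concentration follows once the mean diverges and `r / (n p ^ 2)` tends to zero
(`numEdgesAsymp_of_tendsto_meanSat`). If `n p → ∞`, the trivial bound `r ≤ p` is enough; this covers
`α ≤ 1`. For `α > 1`, `n p` stays bounded and `n r → 0` comes from dominated convergence.

It remains to find `p`. For `α > 1` it is asymptotic to `E(W) ^ m / n`. For `α ≤ 1`, put `s = exp
(-v)` and `Q_k v = exp (α v) * meanSat ν k s`. Averaging over one more weight replaces `Q_k`, up to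
a lower-order error, by `lam * α` times its integral over a left half line ending at `v - log x₀`,
so each weight raises the polynomial degree in `v` by one
(`IsPowerLaw.tendsto_mean_comp_mul_div_pow`). At `α = 1`, `Q_0 → 1` and all `m` weights produce a
logarithm. For `α < 1`, `Q_0` is integrable with integral `π / sin (α π)`: the first weight yields
this constant and only the other `m - 1` yield logarithms. At the end `v = log n`. -/

/-! ### The beta integral in exponential coordinates. -/

theorem integral_exp_mul_div_one_add_exp {α : ℝ} (h0 : 0 < α) (h1 : α < 1) :
    ∫ y : ℝ, Real.exp (α * y) / (1 + Real.exp y) = Real.pi / Real.sin (α * Real.pi) := by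
  have hbeta : (∫ x in Set.Ioo (0 : ℝ) 1, x ^ (α - 1) * (1 - x) ^ (1 - α - 1))
      = Real.pi / Real.sin (α * Real.pi) := by
    have h := beta_eq_betaIntegralReal α (1 - α) h0 (by linarith)
    rw [beta, Real.Gamma_mul_Gamma_one_sub] at h
    rw [mul_comm α, ← integral_Ioc_eq_integral_Ioo, ← intervalIntegral.integral_of_le zero_le_one]
    have h' : Complex.betaIntegral α ((1 - α : ℝ) : ℂ)
        = ((∫ x in (0 : ℝ)..1, x ^ (α - 1) * (1 - x) ^ (1 - α - 1) : ℝ) : ℂ) := by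
      rw [Complex.betaIntegral, ← intervalIntegral.integral_ofReal]
      refine intervalIntegral.integral_congr fun x hx => ?_
      rw [Set.uIcc_of_le zero_le_one] at hx
      have h2 : (0 : ℝ) ≤ 1 - x := by linarith [hx.2]
      simp only [Complex.ofReal_mul]
      rw [Complex.ofReal_cpow hx.1, Complex.ofReal_cpow h2]
      push_cast
      rfl
    rw [h', Complex.ofReal_re] at h
    rw [← h]
    simp
  -- The substitution `x = sigmoid y` carries the line onto `(0, 1)`, with derivative `x * (1 - x)`.
  rw [← hbeta, ← Real.range_sigmoid, ← Set.image_univ,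
    integral_image_eq_integral_abs_deriv_smul MeasurableSet.univ
      (fun x _ => (Real.hasDerivAt_sigmoid x).hasDerivWithinAt)
      Real.sigmoid_injective.injOn]
  rw [setIntegral_univ]
  refine integral_congr_ae (Eventually.of_forall fun y => ?_)
  have hp := Real.sigmoid_pos y
  have hq : 0 < 1 - Real.sigmoid y := by linarith [Real.sigmoid_lt_one y]
  have e1 : 1 - Real.sigmoid y = (1 + Real.exp y)⁻¹ := by
    rw [← Real.sigmoid_neg, Real.sigmoid_def, neg_neg]
  have e2 : Real.sigmoid y = Real.exp y * (1 - Real.sigmoid y) := by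
    have := Real.sigmoid_mul_rexp_neg (-y)
    rw [neg_neg, Real.sigmoid_neg] at this
    linarith
  simp only [smul_eq_mul]
  rw [abs_of_pos (mul_pos hp hq), Real.rpow_sub_one hp.ne', Real.rpow_sub_one hq.ne']
  have e3 : Real.sigmoid y ^ α = Real.exp (α * y) * (1 - Real.sigmoid y) ^ α := by
    conv_lhs => rw [e2]
    rw [Real.mul_rpow (Real.exp_pos _).le hq.le, ← Real.exp_mul, mul_comm y]
  have e4 : (1 - Real.sigmoid y) ^ α * (1 - Real.sigmoid y) ^ (1 - α) = 1 - Real.sigmoid y := by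
    rw [← Real.rpow_add hq]; simp
  field_simp
  rw [e3, mul_assoc, mul_assoc, e4, e1]
  field_simp

/-- A non-integrable function has Bochner integral `0` by convention, but the value computed above
is positive. -/
theorem integrable_exp_mul_div_one_add_exp {α : ℝ} (h0 : 0 < α) (h1 : α < 1) :
    Integrable fun y : ℝ => Real.exp (α * y) / (1 + Real.exp y) := by
  by_contra h
  have h2 := integral_exp_mul_div_one_add_exp h0 h1
  rw [integral_undef h] at h2
  have : 0 < Real.sin (α * Real.pi) :=
    Real.sin_pos_of_pos_of_lt_pi (by positivity) (by nlinarith [Real.pi_pos])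
  have := div_pos Real.pi_pos this
  linarith

/-! ### Integration of functions of polynomial growth. -/

theorem integrableOn_Iic_of_le_exp {α : ℝ} (hα : 0 < α) {Q : ℝ → ℝ} (hm : Measurable Q)
    (h0 : ∀ y, 0 ≤ Q y) (h1 : ∀ y, Q y ≤ Real.exp (α * y)) (V : ℝ) :
    IntegrableOn Q (Set.Iic V) :=
  (integrableOn_exp_mul_Iic hα V).mono' hm.aestronglyMeasurable
    (Eventually.of_forall fun y => by rw [Real.norm_of_nonneg (h0 y)]; exact h1 y)

/-- Integration raises the order of polynomial growth by one. -/
theorem tendsto_integral_Iic_div_pow {α : ℝ} (hα : 0 < α) {Q : ℝ → ℝ} (hm : Measurable Q)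
    (h0 : ∀ y, 0 ≤ Q y) (h1 : ∀ y, Q y ≤ Real.exp (α * y)) {k : ℕ} {c : ℝ}
    (hQ : Tendsto (fun v => Q v / v ^ k) atTop (𝓝 c)) :
    Tendsto (fun v => (∫ y in Set.Iic v, Q y) / v ^ (k + 1)) atTop (𝓝 (c / (k + 1))) := by
  have hpow : Tendsto (fun v : ℝ => v ^ (k + 1)) atTop atTop := tendsto_pow_atTop (by omega)
  have hc : 0 ≤ c := ge_of_tendsto hQ (by
    filter_upwards [eventually_ge_atTop 0] with v hv
    exact div_nonneg (h0 v) (pow_nonneg hv _))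
  -- a polynomial bound for `Q` on the half line
  obtain ⟨C, hC0, hC⟩ : ∃ C : ℝ, 0 ≤ C ∧ ∀ y, 0 ≤ y → Q y ≤ C * (1 + y ^ k) := by
    obtain ⟨v₀, hv₀⟩ := ((hQ.eventually (gt_mem_nhds (lt_add_one c))).and
      (eventually_gt_atTop 0)).exists_forall_of_atTop
    -- Beyond `v₀` the limit gives the factor `c + 1`; before `v₀` the exponential bound is at most
    -- `exp (α * v₀)`.
    refine ⟨c + 1 + Real.exp (α * v₀), by positivity, fun y hy => ?_⟩
    have hyk := pow_nonneg hy k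
    have he := Real.exp_pos (α * v₀)
    rcases le_total v₀ y with h | h
    · obtain ⟨h2, h3⟩ := hv₀ y h
      rw [div_lt_iff₀ (pow_pos h3 k)] at h2
      nlinarith [mul_nonneg he.le hyk]
    · have : Q y ≤ Real.exp (α * v₀) :=
        (h1 y).trans (Real.exp_le_exp.2 (mul_le_mul_of_nonneg_left h hα.le))
      nlinarith [mul_nonneg he.le hyk, mul_nonneg hc hyk]
  have hint := fun V => integrableOn_Iic_of_le_exp hα hm h0 h1 V
  -- Rescaling `y = v * r` fixes the domain, so dominated convergence applies; the integral over the
  -- negative half line is a constant and disappears after division.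
  have key : Tendsto (fun v => ∫ r in Set.Ioc (0 : ℝ) 1, Q (v * r) / v ^ k) atTop
      (𝓝 (∫ r in Set.Ioc (0 : ℝ) 1, c * r ^ k)) := by
    refine tendsto_integral_filter_of_dominated_convergence (fun _ => C * 2) ?_ ?_ ?_ ?_
    · exact Eventually.of_forall fun v =>
        ((hm.comp (measurable_const_mul v)).div_const _).aestronglyMeasurable
    · filter_upwards [eventually_ge_atTop 1] with v hv
      refine (ae_restrict_iff' measurableSet_Ioc).2 (Eventually.of_forall fun r hr => ?_)
      have hv1 : 1 ≤ v ^ k := one_le_pow₀ hv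
      rw [Real.norm_of_nonneg (div_nonneg (h0 _) (by positivity)), div_le_iff₀ (by positivity)]
      refine (hC _ (mul_nonneg (by linarith) hr.1.le)).trans ?_
      have : (v * r) ^ k ≤ v ^ k :=
        pow_le_pow_left₀ (mul_nonneg (by linarith) hr.1.le) (by nlinarith [hr.2]) k
      nlinarith
    · exact integrable_const _
    · refine (ae_restrict_iff' measurableSet_Ioc).2 (Eventually.of_forall fun r hr => ?_)
      have h2 : Tendsto (fun v : ℝ => v * r) atTop atTop := tendsto_id.atTop_mul_const hr.1
      have h3 := (hQ.comp h2).mul_const (r ^ k)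
      refine h3.congr' ?_
      filter_upwards [eventually_gt_atTop 0] with v hv
      have := hr.1
      simp only [Function.comp]
      rw [mul_pow]
      field_simp
  have e : ∫ r in Set.Ioc (0 : ℝ) 1, c * r ^ k = c / (k + 1) := by
    rw [← intervalIntegral.integral_of_le zero_le_one, intervalIntegral.integral_const_mul,
      integral_pow]
    simp
    ring
  rw [e] at key
  have low : Tendsto (fun v : ℝ => (∫ y in Set.Iic 0, Q y) / v ^ (k + 1)) atTop (𝓝 0) :=
    tendsto_const_nhds.div_atTop hpow
  have := low.add key
  rw [zero_add] at this
  refine this.congr' ?_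
  filter_upwards [eventually_gt_atTop 0] with v hv
  have h2 : ∫ y in Set.Iic v, Q y = (∫ y in Set.Iic 0, Q y) + ∫ y in Set.Ioc 0 v, Q y := by
    rw [← setIntegral_union (Set.Iic_disjoint_Ioc le_rfl) measurableSet_Ioc (hint 0)
      ((hint v).mono_set Set.Ioc_subset_Iic_self), Set.Iic_union_Ioc_eq_Iic hv.le]
  have h3 : ∫ r in Set.Ioc (0 : ℝ) 1, Q (v * r) / v ^ k
      = (∫ y in Set.Ioc 0 v, Q y) / v ^ (k + 1) := by
    rw [integral_div, ← intervalIntegral.integral_of_le zero_le_one,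
      ← intervalIntegral.integral_of_le hv.le, intervalIntegral.integral_comp_mul_left _ hv.ne']
    simp only [mul_zero, mul_one, smul_eq_mul]
    field_simp
    ring
  rw [h2, h3, add_div]

/-! ### Power laws in logarithmic coordinates. -/

/-- On its tail, a power law is the image under `exp` of an exponential density. -/
theorem IsPowerLaw.restrict_eq {α lam x₀ : ℝ} (hα : 0 < α) (hlam : 0 < lam) (hx₀ : 0 < x₀)
    {ν : Measure ℝ} (hν : IsPowerLaw α lam x₀ ν) :
    ν.restrict (Set.Ioi x₀) = Measure.map Real.exp
      ((volume.restrict (Set.Ioi (Real.log x₀))).withDensity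
        fun z => ENNReal.ofReal (lam * α * Real.exp (-α * z))) := by
  have := hν.isProbabilityMeasure
  have hd : Measurable fun z : ℝ => ENNReal.ofReal (lam * α * Real.exp (-α * z)) := by fun_prop
  have hI : ∀ t, x₀ ≤ t → ∫⁻ z in Set.Ioi (Real.log t),
      ENNReal.ofReal (lam * α * Real.exp (-α * z)) = ν (Set.Ioi t) := by
    intro t ht
    have ht0 : 0 < t := hx₀.trans_le ht
    rw [← ofReal_integral_eq_lintegral_ofReal
      ((integrableOn_exp_mul_Ioi (by linarith) _).const_mul _)
      (Eventually.of_forall fun z => by positivity), integral_const_mul,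
      integral_exp_mul_Ioi (by linarith), ← ofReal_measureReal, hν.tail t ht,
      Real.rpow_def_of_pos ht0]
    congr 1
    field_simp
  have hmap : ∀ t, x₀ ≤ t → Measure.map Real.exp
      ((volume.restrict (Set.Ioi (Real.log x₀))).withDensity
        fun z => ENNReal.ofReal (lam * α * Real.exp (-α * z))) (Set.Ioi t) = ν (Set.Ioi t) := by
    intro t ht
    have ht0 : 0 < t := hx₀.trans_le ht
    rw [Measure.map_apply Real.measurable_exp measurableSet_Ioi,
      withDensity_apply _ (Real.measurable_exp measurableSet_Ioi),
      Measure.restrict_restrict (Real.measurable_exp measurableSet_Ioi), ← hI t ht]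
    congr 2
    ext z
    simp only [Set.mem_inter_iff, Set.mem_preimage, Set.mem_Ioi, ← Real.log_lt_iff_lt_exp ht0]
    exact ⟨fun h => h.1, fun h => ⟨h, (Real.log_le_log hx₀ ht).trans_lt h⟩⟩
  have hlow : Measure.map Real.exp
      ((volume.restrict (Set.Ioi (Real.log x₀))).withDensity
        fun z => ENNReal.ofReal (lam * α * Real.exp (-α * z))) (Set.Iic x₀) = 0 := by
    rw [Measure.map_apply Real.measurable_exp measurableSet_Iic,
      withDensity_apply _ (Real.measurable_exp measurableSet_Iic),
      Measure.restrict_restrict (Real.measurable_exp measurableSet_Iic)]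
    have : Real.exp ⁻¹' Set.Iic x₀ ∩ Set.Ioi (Real.log x₀) = ∅ := by
      ext z
      simp only [Set.mem_inter_iff, Set.mem_preimage, Set.mem_Iic, Set.mem_Ioi,
        Set.mem_empty_iff_false, iff_false, not_and, not_lt]
      exact fun h => (Real.le_log_iff_exp_le hx₀).2 h
    rw [this]
    simp
  have huniv : ∀ μ : Measure ℝ, μ (Set.Iic x₀) = 0 → μ Set.univ = μ (Set.Ioi x₀) := by
    intro μ hμ
    rw [← Set.Iic_union_Ioi (a := x₀)]
    refine le_antisymm ((measure_union_le _ _).trans (by rw [hμ, zero_add]))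
      (measure_mono Set.subset_union_right)
  have hνlow : ν.restrict (Set.Ioi x₀) (Set.Iic x₀) = 0 := by
    rw [Measure.restrict_apply measurableSet_Iic, Set.Iic_inter_Ioi, Set.Ioc_self, measure_empty]
  have hun : ν.restrict (Set.Ioi x₀) Set.univ = Measure.map Real.exp
      ((volume.restrict (Set.Ioi (Real.log x₀))).withDensity
        fun z => ENNReal.ofReal (lam * α * Real.exp (-α * z))) Set.univ := by
    rw [huniv _ hlow, hmap x₀ le_rfl, Measure.restrict_apply_univ]
  have hgen : borel ℝ = MeasurableSpace.generateFrom (Set.range Set.Ioi) := borel_eq_generateFrom_Ioi ℝ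
  -- Both measures are finite, so comparing them on rays suffices. A ray starting below `x₀` carries
  -- the total mass, as neither measure charges `Set.Iic x₀`.
  refine ext_of_generate_finite _ (BorelSpace.measurable_eq.trans hgen) isPiSystem_Ioi ?_ hun
  rintro _ ⟨t, rfl⟩
  rcases le_total x₀ t with h | h
  · rw [hmap t h, Measure.restrict_apply measurableSet_Ioi,
      Set.inter_eq_left.2 (Set.Ioi_subset_Ioi h)]
  · have hx : ∀ μ : Measure ℝ, μ (Set.Iic x₀) = 0 → μ (Set.Ioi t) = μ Set.univ := by
      intro μ hμ
      rw [huniv μ hμ]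
      refine le_antisymm ?_ (measure_mono (Set.Ioi_subset_Ioi h))
      rw [← huniv μ hμ]
      exact measure_mono (Set.subset_univ _)
    rw [hx _ hνlow, hx _ hlow, hun]

/-- Substitute `w = exp z`, then `y = v - z`: the density `exp (-α z)` and the prefactor `exp (α v)`
combine to `exp (α y)`, turning multiplication by a weight into integration up to `v - log x₀`. -/
theorem IsPowerLaw.setIntegral_comp_mul {α lam x₀ : ℝ} (hα : 0 < α) (hlam : 0 < lam)
    (hx₀ : 0 < x₀) {ν : Measure ℝ} (hν : IsPowerLaw α lam x₀ ν) {g : ℝ → ℝ} (hg : Measurable g)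
    (v : ℝ) :
    Real.exp (α * v) * ∫ w in Set.Ioi x₀, g (Real.exp (-v) * w) ∂ν
      = lam * α * ∫ y in Set.Iic (v - Real.log x₀), Real.exp (α * y) * g (Real.exp (-y)) := by
  have hg' : Measurable fun w => g (Real.exp (-v) * w) := hg.comp (measurable_const_mul _)
  rw [hν.restrict_eq hα hlam hx₀, integral_map Real.measurable_exp.aemeasurable
      hg'.aestronglyMeasurable,
    integral_withDensity_eq_integral_toReal_smul (by fun_prop)
      (Eventually.of_forall fun _ => ENNReal.ofReal_lt_top),
    ← integral_const_mul, ← integral_const_mul, integral_Iic_eq_integral_Iio]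
  have e : (fun y => v - y) ⁻¹' Set.Iio (v - Real.log x₀) = Set.Ioi (Real.log x₀) := by
    ext y; simp
  rw [← (Measure.measurePreserving_sub_left volume v).setIntegral_preimage_emb
    (MeasurableEquiv.subLeft v).measurableEmbedding
    (fun y => lam * α * (Real.exp (α * y) * g (Real.exp (-y)))) (Set.Iio (v - Real.log x₀)), e]
  refine integral_congr_ae (Eventually.of_forall fun z => ?_)
  simp only [smul_eq_mul]
  rw [ENNReal.toReal_ofReal (by positivity), ← Real.exp_add]
  have e1 : Real.exp (α * (v - z)) = Real.exp (α * v) * Real.exp (-α * z) := by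
    rw [← Real.exp_add]; ring_nf
  rw [e1]
  have e2 : -v + z = -(v - z) := by ring
  rw [e2]
  ring

theorem IsPowerLaw.integrable_id {α lam x₀ : ℝ} (hα : 1 < α) (hlam : 0 < lam)
    (hx₀ : 0 < x₀) {ν : Measure ℝ} (hν : IsPowerLaw α lam x₀ ν) :
    Integrable (fun x : ℝ => x) ν := by
  have := hν.isProbabilityMeasure
  rw [← integrableOn_univ, ← Set.Iic_union_Ioi (a := x₀)]
  refine IntegrableOn.union ?_ ?_
  · refine Integrable.mono' (integrable_const x₀) (by fun_prop) ?_
    filter_upwards [ae_restrict_mem measurableSet_Iic, ae_restrict_of_ae hν.nonneg] with x h1 h2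
    rw [Real.norm_of_nonneg h2]
    exact h1
  · rw [IntegrableOn, hν.restrict_eq (by linarith) hlam hx₀,
      integrable_map_measure (by fun_prop) (by fun_prop),
      integrable_withDensity_iff_integrable_smul₀' (by fun_prop)
        (Eventually.of_forall fun _ => ENNReal.ofReal_lt_top)]
    have h := (integrableOn_exp_mul_Ioi (a := 1 - α) (by linarith) (Real.log x₀)).const_mul
      (lam * α)
    refine h.congr (Eventually.of_forall fun z => ?_)
    simp only [Function.comp, smul_eq_mul]
    rw [ENNReal.toReal_ofReal (by have : 0 < α := by linarith
                                  positivity), mul_assoc (lam * α), ← Real.exp_add]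
    ring_nf

theorem IsPowerLaw.integral_id_pos {α lam x₀ : ℝ} (hα : 1 < α) (hlam : 0 < lam)
    (hx₀ : 0 < x₀) {ν : Measure ℝ} (hν : IsPowerLaw α lam x₀ ν) : 0 < ∫ x, x ∂ν := by
  have := hν.isProbabilityMeasure
  have h := mul_meas_ge_le_integral_of_nonneg hν.nonneg (hν.integrable_id hα hlam hx₀) x₀
  have h2 : ν.real (Set.Ioi x₀) ≤ ν.real {x | x₀ ≤ x} :=
    measureReal_mono fun x (hx : x₀ < x) => show x₀ ≤ x from hx.le
  rw [hν.tail x₀ le_rfl] at h2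
  have h3 : 0 < lam * x₀ ^ (-α) := by positivity
  nlinarith

/-! ### Saturation and its means over products of weights. -/

/-- The saturation `|x| / (1 + |x|)`. -/
noncomputable def sat (x : ℝ) : ℝ := |x| / (1 + |x|)

theorem sat_nonneg (x : ℝ) : 0 ≤ sat x := by unfold sat; positivity

theorem sat_le_one (x : ℝ) : sat x ≤ 1 := by
  unfold sat
  rw [div_le_one (by positivity)]
  linarith

theorem sat_le_abs (x : ℝ) : sat x ≤ |x| :=
  div_le_self (abs_nonneg x) (by linarith [abs_nonneg x])

theorem norm_sat_le_one (x : ℝ) : ‖sat x‖ ≤ 1 := by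
  rw [Real.norm_of_nonneg (sat_nonneg x)]; exact sat_le_one x

theorem continuous_sat : Continuous sat :=
  continuous_abs.div (continuous_const.add continuous_abs) fun x => by positivity

theorem sat_mono {x y : ℝ} (h : |x| ≤ |y|) : sat x ≤ sat y := by
  unfold sat
  rw [div_le_div_iff₀ (by positivity) (by positivity)]
  nlinarith

theorem sat_exp_neg (y : ℝ) : sat (Real.exp (-y)) = (1 + Real.exp y)⁻¹ := by
  unfold sat
  rw [abs_of_pos (Real.exp_pos _), Real.exp_neg]
  field_simp
  ring

/-- The law of a product of `k` independent random variables of law `ν`. -/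
noncomputable def mulPow (ν : Measure ℝ) : ℕ → Measure ℝ
  | 0 => Measure.dirac 1
  | k + 1 => ν ∗ₘ mulPow ν k

instance isProbabilityMeasure_mulPow (ν : Measure ℝ) [IsProbabilityMeasure ν] (k : ℕ) :
    IsProbabilityMeasure (mulPow ν k) := by
  induction k with
  | zero => unfold mulPow; infer_instance
  | succ k ih =>
    unfold mulPow Measure.mconv
    exact Measure.isProbabilityMeasure_map (by fun_prop)

/-- The mean of `sat (s * X)` for a product `X` of `k` independent variables of law `ν`. -/
noncomputable def meanSat (ν : Measure ℝ) (k : ℕ) (s : ℝ) : ℝ := ∫ x, sat (s * x) ∂mulPow ν k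

theorem integrable_sat_comp {Ω : Type*} [MeasurableSpace Ω] {μ : Measure Ω} [IsFiniteMeasure μ]
    {X : Ω → ℝ} (hX : Measurable X) : Integrable (fun ω => sat (X ω)) μ :=
  Integrable.of_bound (continuous_sat.measurable.comp hX).aestronglyMeasurable 1
    (Eventually.of_forall fun _ => norm_sat_le_one _)

theorem meanSat_nonneg (ν : Measure ℝ) (k : ℕ) (s : ℝ) : 0 ≤ meanSat ν k s :=
  integral_nonneg fun _ => sat_nonneg _

theorem meanSat_zero (ν : Measure ℝ) (s : ℝ) : meanSat ν 0 s = sat s := by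
  simp [meanSat, mulPow]

section

variable (ν : Measure ℝ) [IsProbabilityMeasure ν]

theorem meanSat_le_one (k : ℕ) (s : ℝ) : meanSat ν k s ≤ 1 := by
  have h := integral_mono (μ := mulPow ν k) (integrable_sat_comp (measurable_const_mul s))
    (integrable_const 1) fun x => sat_le_one (s * x)
  simpa [meanSat] using h

theorem meanSat_mono (k : ℕ) {s t : ℝ} (hs : 0 ≤ s) (hst : s ≤ t) :
    meanSat ν k s ≤ meanSat ν k t := by
  refine integral_mono (integrable_sat_comp (measurable_const_mul s))
    (integrable_sat_comp (measurable_const_mul t)) fun x => sat_mono ?_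
  rw [abs_mul, abs_mul, abs_of_nonneg hs, abs_of_nonneg (hs.trans hst)]
  exact mul_le_mul_of_nonneg_right hst (abs_nonneg x)

theorem measurable_meanSat (k : ℕ) : Measurable (meanSat ν k) := by
  have h : StronglyMeasurable (fun p : ℝ × ℝ => sat (p.1 * p.2)) :=
    (continuous_sat.comp (continuous_fst.mul continuous_snd)).stronglyMeasurable
  exact (h.integral_prod_right' (ν := mulPow ν k)).measurable

/-- Fubini, splitting off one factor of the product; this recursion drives the asymptotics for `α ≤
1`. -/
theorem meanSat_succ (k : ℕ) (s : ℝ) : meanSat ν (k + 1) s = ∫ w, meanSat ν k (s * w) ∂ν := by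
  have := isProbabilityMeasure_mulPow ν (k + 1)
  unfold meanSat
  have h : Integrable (fun x => sat (s * x)) (ν ∗ₘ mulPow ν k) :=
    integrable_sat_comp (μ := mulPow ν (k + 1)) (measurable_const_mul s)
  rw [show mulPow ν (k + 1) = ν ∗ₘ mulPow ν k from rfl, integral_mconv h]
  simp only [mul_assoc]

end

/-! ### Asymptotics of the mean saturation under a power law. -/

section

variable {α lam x₀ : ℝ} {ν : Measure ℝ} {g : ℝ → ℝ}

/-- The difference is the contribution of weights at most `x₀`, about which only nonnegativity is
known. Monotonicity of `g` bounds it by the value at `x₀`, that is, by the integrand at the endpoint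
`v - log x₀`. -/
theorem IsPowerLaw.mean_comp_mul_sub_mem (hα : 0 < α) (hlam : 0 < lam) (hx₀ : 0 < x₀)
    (hν : IsPowerLaw α lam x₀ ν) (hg : Measurable g) (h0 : ∀ s, 0 ≤ g s) (h1 : ∀ s, g s ≤ 1)
    (hmono : ∀ s t, 0 ≤ s → s ≤ t → g s ≤ g t) (v : ℝ) :
    Real.exp (α * v) * (∫ w, g (Real.exp (-v) * w) ∂ν)
      - lam * α * ∫ y in Set.Iic (v - Real.log x₀), Real.exp (α * y) * g (Real.exp (-y)) ∈
    Set.Icc 0 (x₀ ^ α * (Real.exp (α * (v - Real.log x₀)) * g (Real.exp (-(v - Real.log x₀))))) := by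
  have := hν.isProbabilityMeasure
  have hi : Integrable (fun w => g (Real.exp (-v) * w)) ν :=
    Integrable.of_bound (hg.comp (measurable_const_mul _)).aestronglyMeasurable 1
      (Eventually.of_forall fun _ => by rw [Real.norm_of_nonneg (h0 _)]; exact h1 _)
  rw [← hν.setIntegral_comp_mul hα hlam hx₀ hg v, ← mul_sub,
    ← integral_add_compl (measurableSet_Iic (a := x₀)) hi, Set.compl_Iic, add_sub_cancel_right]
  refine ⟨mul_nonneg (Real.exp_pos _).le (integral_nonneg fun _ => h0 _), ?_⟩
  have e1 : Real.exp (-(v - Real.log x₀)) = Real.exp (-v) * x₀ := by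
    rw [neg_sub, sub_eq_neg_add, Real.exp_add, Real.exp_log hx₀]
  have e2 : x₀ ^ α * Real.exp (α * (v - Real.log x₀)) = Real.exp (α * v) := by
    rw [Real.rpow_def_of_pos hx₀, ← Real.exp_add]
    ring_nf
  rw [← mul_assoc, e2, e1]
  refine mul_le_mul_of_nonneg_left ?_ (Real.exp_pos _).le
  have h2 : ∫ w in Set.Iic x₀, g (Real.exp (-v) * w) ∂ν
      ≤ ∫ _ in Set.Iic x₀, g (Real.exp (-v) * x₀) ∂ν := by
    refine integral_mono_ae hi.integrableOn (integrable_const _) ?_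
    filter_upwards [ae_restrict_mem measurableSet_Iic, ae_restrict_of_ae hν.nonneg] with w hw hw0
    exact hmono _ _ (mul_nonneg (Real.exp_pos _).le hw0)
      (mul_le_mul_of_nonneg_left hw (Real.exp_pos _).le)
  refine h2.trans ?_
  rw [setIntegral_const, smul_eq_mul]
  exact mul_le_of_le_one_left (h0 _) measureReal_le_one

theorem tendsto_sub_const_div_self (b : ℝ) :
    Tendsto (fun v : ℝ => (v - b) / v) atTop (𝓝 1) := by
  have h : Tendsto (fun v : ℝ => 1 - b / v) atTop (𝓝 (1 - 0)) :=
    tendsto_const_nhds.sub (tendsto_const_nhds.div_atTop tendsto_id)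
  rw [sub_zero] at h
  refine h.congr' ?_
  filter_upwards [eventually_gt_atTop 0] with v hv
  field_simp

theorem tendsto_comp_sub_const_div_pow {f : ℝ → ℝ} {k : ℕ} {c : ℝ} (b : ℝ)
    (hf : Tendsto (fun v => f v / v ^ k) atTop (𝓝 c)) :
    Tendsto (fun v => f (v - b) / v ^ k) atTop (𝓝 c) := by
  have h1 := (hf.comp (tendsto_atTop_add_const_right atTop (-b) tendsto_id)).mul
    ((tendsto_sub_const_div_self b).pow k)
  rw [one_pow, mul_one] at h1
  refine h1.congr' ?_
  filter_upwards [eventually_gt_atTop 0, eventually_gt_atTop b] with v hv hb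
  have : v - b ≠ 0 := by linarith
  simp only [Function.comp, id, ← sub_eq_add_neg]
  rw [div_pow]
  field_simp

/-- Averaging over a power law multiplies the asymptotics by a logarithm. -/
theorem IsPowerLaw.tendsto_mean_comp_mul_div_pow (hα : 0 < α) (hlam : 0 < lam) (hx₀ : 0 < x₀)
    (hν : IsPowerLaw α lam x₀ ν) (hg : Measurable g) (h0 : ∀ s, 0 ≤ g s) (h1 : ∀ s, g s ≤ 1)
    (hmono : ∀ s t, 0 ≤ s → s ≤ t → g s ≤ g t) {k : ℕ} {c : ℝ}
    (hlim : Tendsto (fun v => Real.exp (α * v) * g (Real.exp (-v)) / v ^ k) atTop (𝓝 c)) :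
    Tendsto (fun v => Real.exp (α * v) * (∫ w, g (Real.exp (-v) * w) ∂ν) / v ^ (k + 1)) atTop
      (𝓝 (lam * α * (c / (k + 1)))) := by
  set b := Real.log x₀
  set Q : ℝ → ℝ := fun y => Real.exp (α * y) * g (Real.exp (-y)) with hQ
  have hQm : Measurable Q := by fun_prop
  have hA := (tendsto_comp_sub_const_div_pow (f := fun v => ∫ y in Set.Iic v, Q y) b
    (tendsto_integral_Iic_div_pow hα hQm (fun y => mul_nonneg (Real.exp_pos _).le (h0 _))
      (fun y => mul_le_of_le_one_right (Real.exp_pos _).le (h1 _)) hlim)).const_mul (lam * α)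
  -- The error from small weights has order `v ^ k`, one power below the main term.
  have hB : Tendsto (fun v => x₀ ^ α * (Q (v - b) / v ^ k * v⁻¹)) atTop (𝓝 0) := by
    have := ((tendsto_comp_sub_const_div_pow (f := Q) b hlim).mul
      tendsto_inv_atTop_zero).const_mul (x₀ ^ α)
    simpa using this
  have hC : Tendsto (fun v => (Real.exp (α * v) * (∫ w, g (Real.exp (-v) * w) ∂ν)
      - lam * α * ∫ y in Set.Iic (v - b), Q y) / v ^ (k + 1)) atTop (𝓝 0) := by
    refine squeeze_zero' ?_ ?_ hB
    · filter_upwards [eventually_gt_atTop 0] with v hv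
      exact div_nonneg
        (hν.mean_comp_mul_sub_mem hα hlam hx₀ hg h0 h1 hmono v).1 (by positivity)
    · filter_upwards [eventually_gt_atTop 0] with v hv
      rw [div_le_iff₀ (by positivity)]
      refine (hν.mean_comp_mul_sub_mem hα hlam hx₀ hg h0 h1 hmono v).2.trans (le_of_eq ?_)
      simp only [hQ, b]
      field_simp
      ring
  have := hA.add hC
  rw [add_zero] at this
  refine this.congr fun v => ?_
  ring

/-- With an integrable integrand the half-line integrals converge instead of growing, so this
averaging produces no logarithm. -/
theorem IsPowerLaw.tendsto_mean_comp_mul_of_integrable (hα : 0 < α) (hlam : 0 < lam)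
    (hx₀ : 0 < x₀) (hν : IsPowerLaw α lam x₀ ν) (hg : Measurable g) (h0 : ∀ s, 0 ≤ g s)
    (h1 : ∀ s, g s ≤ 1) (hmono : ∀ s t, 0 ≤ s → s ≤ t → g s ≤ g t)
    (hint : Integrable fun y => Real.exp (α * y) * g (Real.exp (-y)))
    (hlim : Tendsto (fun v => Real.exp (α * v) * g (Real.exp (-v))) atTop (𝓝 0)) :
    Tendsto (fun v => Real.exp (α * v) * ∫ w, g (Real.exp (-v) * w) ∂ν) atTop
      (𝓝 (lam * α * ∫ y, Real.exp (α * y) * g (Real.exp (-y)))) := by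
  have hs : Tendsto (fun v : ℝ => v - Real.log x₀) atTop atTop :=
    tendsto_atTop_add_const_right _ (-Real.log x₀) tendsto_id
  have hA : Tendsto (fun v => ∫ y in Set.Iic (v - Real.log x₀),
      Real.exp (α * y) * g (Real.exp (-y))) atTop
      (𝓝 (∫ y, Real.exp (α * y) * g (Real.exp (-y)))) :=
    (aecover_Iic hs).integral_tendsto_of_countably_generated hint
  have hB := (hlim.comp hs).const_mul (x₀ ^ α)
  rw [mul_zero] at hB
  have hC := squeeze_zero
    (fun v => (hν.mean_comp_mul_sub_mem hα hlam hx₀ hg h0 h1 hmono v).1)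
    (fun v => (hν.mean_comp_mul_sub_mem hα hlam hx₀ hg h0 h1 hmono v).2) hB
  have := (hA.const_mul (lam * α)).add hC
  rw [add_zero] at this
  exact this.congr fun v => by ring

theorem IsPowerLaw.tendsto_meanSat_succ_exp (hα : 0 < α) (hlam : 0 < lam) (hx₀ : 0 < x₀)
    (hν : IsPowerLaw α lam x₀ ν) {j k : ℕ} {c : ℝ}
    (hlim : Tendsto (fun v => Real.exp (α * v) * meanSat ν j (Real.exp (-v)) / v ^ k) atTop
      (𝓝 c)) :
    Tendsto (fun v => Real.exp (α * v) * meanSat ν (j + 1) (Real.exp (-v)) / v ^ (k + 1)) atTop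
      (𝓝 (lam * α * (c / (k + 1)))) := by
  have := hν.isProbabilityMeasure
  simp only [meanSat_succ]
  exact hν.tendsto_mean_comp_mul_div_pow hα hlam hx₀ (measurable_meanSat ν j)
    (meanSat_nonneg ν j) (meanSat_le_one ν j) (fun s t => meanSat_mono ν j) hlim

/-- The first factor is absorbed by the convergent beta integral; the remaining `k` successive
integrations of a constant give `v ^ k / k!`. -/
theorem IsPowerLaw.tendsto_meanSat_exp_of_lt_one (hα : 0 < α) (hα1 : α < 1) (hlam : 0 < lam)
    (hx₀ : 0 < x₀) (hν : IsPowerLaw α lam x₀ ν) (k : ℕ) :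
    Tendsto (fun v => Real.exp (α * v) * meanSat ν (k + 1) (Real.exp (-v)) / v ^ k) atTop
      (𝓝 ((lam * α) ^ (k + 1) / k.factorial * (Real.pi / Real.sin (α * Real.pi)))) := by
  have := hν.isProbabilityMeasure
  induction k with
  | zero =>
    have e : ∀ y : ℝ, Real.exp (α * y) * meanSat ν 0 (Real.exp (-y))
        = Real.exp (α * y) / (1 + Real.exp y) := fun y => by
      rw [meanSat_zero, sat_exp_neg, div_eq_mul_inv]
    have h := hν.tendsto_mean_comp_mul_of_integrable hα hlam hx₀ (measurable_meanSat ν 0)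
      (meanSat_nonneg ν 0) (meanSat_le_one ν 0) (fun s t => meanSat_mono ν 0)
      (by simp only [e]; exact integrable_exp_mul_div_one_add_exp hα hα1)
      (by
        simp only [e]
        have h2 : Tendsto (fun v : ℝ => Real.exp ((α - 1) * v)) atTop (𝓝 0) :=
          Real.tendsto_exp_atBot.comp (tendsto_id.const_mul_atTop_of_neg (by linarith))
        refine squeeze_zero (fun v => by positivity) (fun v => ?_) h2
        rw [div_le_iff₀ (by positivity), mul_add, ← Real.exp_add]
        have : (α - 1) * v + v = α * v := by ring
        rw [this]
        linarith [Real.exp_pos ((α - 1) * v)])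
    simp only [e, integral_exp_mul_div_one_add_exp hα hα1] at h
    simpa [meanSat_succ] using h
  | succ k ih =>
    have h := hν.tendsto_meanSat_succ_exp hα hlam hx₀ ih
    convert h using 2
    rw [Nat.factorial_succ]
    push_cast
    field_simp
    ring

/-- Here the initial function tends to `1`, so already the first integration diverges linearly and
`k` factors give `v ^ k / k!`. -/
theorem IsPowerLaw.tendsto_meanSat_exp_of_eq_one (hlam : 0 < lam)
    (hx₀ : 0 < x₀) (hν : IsPowerLaw 1 lam x₀ ν) (k : ℕ) :
    Tendsto (fun v => Real.exp v * meanSat ν k (Real.exp (-v)) / v ^ k) atTop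
      (𝓝 (lam ^ k / k.factorial)) := by
  have := hν.isProbabilityMeasure
  induction k with
  | zero =>
    have h2 : Tendsto (fun v : ℝ => (Real.exp (-v) + 1)⁻¹) atTop (𝓝 (0 + 1)⁻¹) :=
      ((Real.tendsto_exp_neg_atTop_nhds_zero).add_const 1).inv₀ (by norm_num)
    have e : lam ^ 0 / ((Nat.factorial 0 : ℕ) : ℝ) = (0 + 1 : ℝ)⁻¹ := by simp
    rw [e]
    refine h2.congr fun v => ?_
    rw [meanSat_zero, sat_exp_neg, Real.exp_neg]
    field_simp
  | succ k ih =>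
    have h := hν.tendsto_meanSat_succ_exp (j := k) (k := k) one_pos hlam hx₀ (by simpa using ih)
    simp only [one_mul] at h
    convert h using 2
    rw [Nat.factorial_succ]
    push_cast
    field_simp
    ring

theorem IsPowerLaw.tendsto_meanSat_of_lt_one (hα : 0 < α) (hα1 : α < 1) (hlam : 0 < lam)
    (hx₀ : 0 < x₀) (hν : IsPowerLaw α lam x₀ ν) (k : ℕ) :
    Tendsto (fun n : ℕ => (n : ℝ) ^ α * meanSat ν (k + 1) (n : ℝ)⁻¹ / Real.log n ^ k) atTop
      (𝓝 ((lam * α) ^ (k + 1) / k.factorial * (Real.pi / Real.sin (α * Real.pi)))) := by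
  refine ((hν.tendsto_meanSat_exp_of_lt_one hα hα1 hlam hx₀ k).comp
    (Real.tendsto_log_atTop.comp tendsto_natCast_atTop_atTop)).congr' ?_
  filter_upwards [eventually_gt_atTop 0] with n hn
  have hn' : (0 : ℝ) < n := by exact_mod_cast hn
  simp only [Function.comp]
  rw [Real.exp_neg, Real.exp_log hn', Real.rpow_def_of_pos hn', mul_comm α]

theorem IsPowerLaw.tendsto_meanSat_of_eq_one (hlam : 0 < lam)
    (hx₀ : 0 < x₀) (hν : IsPowerLaw 1 lam x₀ ν) (k : ℕ) :
    Tendsto (fun n : ℕ => (n : ℝ) * meanSat ν k (n : ℝ)⁻¹ / Real.log n ^ k) atTop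
      (𝓝 (lam ^ k / k.factorial)) := by
  refine ((hν.tendsto_meanSat_exp_of_eq_one hlam hx₀ k).comp
    (Real.tendsto_log_atTop.comp tendsto_natCast_atTop_atTop)).congr' ?_
  filter_upwards [eventually_gt_atTop 0] with n hn
  have hn' : (0 : ℝ) < n := by exact_mod_cast hn
  simp only [Function.comp]
  rw [Real.exp_neg, Real.exp_log hn']

end

/-! ### Mean saturation for integrable weights. -/

theorem ae_nonneg_mulPow {ν : Measure ℝ} (h : ∀ᵐ x ∂ν, 0 ≤ x) (k : ℕ) : ∀ᵐ x ∂mulPow ν k, 0 ≤ x := by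
  induction k with
  | zero => simp [mulPow, ae_dirac_eq]
  | succ k ih =>
    rw [show mulPow ν (k + 1) = ν ∗ₘ mulPow ν k from rfl, Measure.mconv,
      ae_map_iff (by fun_prop) measurableSet_Ici]
    have h1 : ∀ᵐ p ∂ν.prod (mulPow ν k), 0 ≤ p.1 := Measure.quasiMeasurePreserving_fst.ae h
    have h2 : ∀ᵐ p ∂ν.prod (mulPow ν k), 0 ≤ p.2 := Measure.quasiMeasurePreserving_snd.ae ih
    filter_upwards [h1, h2] with p hp1 hp2 using mul_nonneg hp1 hp2

section

variable {ν : Measure ℝ} [IsProbabilityMeasure ν]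

theorem integrable_id_mulPow (hi : Integrable (fun x : ℝ => x) ν) (k : ℕ) :
    Integrable (fun x : ℝ => x) (mulPow ν k) := by
  induction k with
  | zero => exact integrable_dirac (by simp)
  | succ k ih =>
    rw [show mulPow ν (k + 1) = ν ∗ₘ mulPow ν k from rfl, integrable_mconv_iff (by fun_prop)]
    refine ⟨Eventually.of_forall fun x => ih.const_mul x, ?_⟩
    simp only [norm_mul, integral_const_mul]
    exact hi.norm.mul_const _

theorem integral_id_mulPow (hi : Integrable (fun x : ℝ => x) ν) (k : ℕ) :
    ∫ x, x ∂mulPow ν k = (∫ x, x ∂ν) ^ k := by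
  induction k with
  | zero => simp [mulPow]
  | succ k ih =>
    rw [show mulPow ν (k + 1) = ν ∗ₘ mulPow ν k from rfl,
      integral_mconv (integrable_id_mulPow hi (k + 1))]
    have h : ∀ x : ℝ, ∫ y, x * y ∂mulPow ν k = x * (∫ y, y ∂ν) ^ k := fun x => by
      rw [← ih]
      exact integral_const_mul x _
    simp only [h]
    rw [pow_succ', ← ih]
    exact integral_mul_const _ _

/-- For `x ≥ 0`, `n * sat (x / n)` is `x / (1 + x / n)`, which tends to `x` and is dominated by the
integrable `|x|`. -/
theorem tendsto_nat_mul_meanSat (h : ∀ᵐ x ∂ν, 0 ≤ x) (hi : Integrable (fun x : ℝ => x) ν)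
    (k : ℕ) :
    Tendsto (fun n : ℕ => (n : ℝ) * meanSat ν k (n : ℝ)⁻¹) atTop (𝓝 ((∫ x, x ∂ν) ^ k)) := by
  rw [← integral_id_mulPow hi k]
  simp only [meanSat, ← integral_const_mul]
  refine tendsto_integral_filter_of_dominated_convergence (fun x => |x|) ?_ ?_
    (integrable_id_mulPow hi k).norm ?_
  · exact Eventually.of_forall fun n => (continuous_const.mul
      (continuous_sat.comp (continuous_const_mul _))).aestronglyMeasurable
  · filter_upwards [eventually_gt_atTop 0] with n hn
    have hn' : (0 : ℝ) < n := by exact_mod_cast hn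
    refine Eventually.of_forall fun x => ?_
    rw [Real.norm_of_nonneg (mul_nonneg hn'.le (sat_nonneg _))]
    refine (mul_le_mul_of_nonneg_left (sat_le_abs _) hn'.le).trans (le_of_eq ?_)
    rw [abs_mul, abs_of_pos (inv_pos.2 hn')]
    field_simp
  · filter_upwards [ae_nonneg_mulPow h k] with x hx
    have hlim : Tendsto (fun n : ℕ => x / (1 + |(n : ℝ)⁻¹ * x|)) atTop
        (𝓝 (x / (1 + |0 * x|))) :=
      tendsto_const_nhds.div (((tendsto_inv_atTop_nhds_zero_nat).mul_const x).abs.const_add 1)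
        (by positivity)
    simp only [zero_mul, abs_zero, add_zero, div_one] at hlim
    refine hlim.congr' ?_
    filter_upwards [eventually_gt_atTop 0] with n hn
    have hn' : (0 : ℝ) < n := by exact_mod_cast hn
    unfold sat
    rw [abs_of_nonneg (by positivity : 0 ≤ (n : ℝ)⁻¹ * x)]
    field_simp

/-- `n * sat (x / n) ^ 2` is at most both `|x|` and `x ^ 2 / n`: the first bound dominates, the
second gives the pointwise limit, and no second moment of the weights is needed. -/
theorem tendsto_nat_mul_mean_sat_sq (hi : Integrable (fun x : ℝ => x) ν) (k : ℕ) :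
    Tendsto (fun n : ℕ => (n : ℝ) * ∫ x, sat ((n : ℝ)⁻¹ * x) ^ 2 ∂mulPow ν k) atTop (𝓝 0) := by
  rw [← integral_zero ℝ ℝ (μ := mulPow ν k)]
  simp only [← integral_const_mul]
  refine tendsto_integral_filter_of_dominated_convergence (fun x => |x|) ?_ ?_
    (integrable_id_mulPow hi k).norm ?_
  · exact Eventually.of_forall fun n => (continuous_const.mul
      ((continuous_sat.comp (continuous_const_mul _)).pow 2)).aestronglyMeasurable
  · filter_upwards [eventually_gt_atTop 0] with n hn
    have hn' : (0 : ℝ) < n := by exact_mod_cast hn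
    refine Eventually.of_forall fun x => ?_
    rw [Real.norm_of_nonneg (mul_nonneg hn'.le (sq_nonneg _))]
    have h1 : sat ((n : ℝ)⁻¹ * x) ^ 2 ≤ sat ((n : ℝ)⁻¹ * x) :=
      pow_le_of_le_one (sat_nonneg _) (sat_le_one _) two_ne_zero
    refine (mul_le_mul_of_nonneg_left (h1.trans (sat_le_abs _)) hn'.le).trans (le_of_eq ?_)
    rw [abs_mul, abs_of_pos (inv_pos.2 hn')]
    field_simp
  · refine Eventually.of_forall fun x => ?_
    have h0 : Tendsto (fun n : ℕ => |x| * |x| * (n : ℝ)⁻¹) atTop (𝓝 0) := by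
      simpa using (tendsto_inv_atTop_nhds_zero_nat (𝕜 := ℝ)).const_mul (|x| * |x|)
    refine squeeze_zero' (Eventually.of_forall fun n => by positivity) ?_ h0
    filter_upwards [eventually_gt_atTop 0] with n hn
    have hn' : (0 : ℝ) < n := by exact_mod_cast hn
    have h2 := pow_le_pow_left₀ (sat_nonneg _) (sat_le_abs ((n : ℝ)⁻¹ * x)) 2
    refine (mul_le_mul_of_nonneg_left h2 hn'.le).trans (le_of_eq ?_)
    rw [abs_mul, abs_of_pos (inv_pos.2 hn')]
    field_simp

end

/-! ### Products over vertex sets and counting of intersecting pairs. -/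

theorem measurable_sat_const_mul (s : ℝ) : Measurable fun x => sat (s * x) :=
  continuous_sat.measurable.comp (measurable_const_mul s)

theorem map_finset_prod_eq_mulPow {Ω ι : Type*} [MeasurableSpace Ω] {P : Measure Ω}
    [IsProbabilityMeasure P] {ν : Measure ℝ} {X : ι → Ω → ℝ} (hX : ∀ i, Measurable (X i))
    (hlaw : ∀ i, Measure.map (X i) P = ν) (hind : iIndepFun X P) (s : Finset ι) :
    Measure.map (∏ i ∈ s, X i) P = mulPow ν s.card := by
  classical
  induction s using Finset.induction_on with
  | empty =>
    rw [Finset.prod_empty, Finset.card_empty, mulPow]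
    change Measure.map (fun _ => (1 : ℝ)) P = _
    rw [Measure.map_const, measure_univ, one_smul]
  | insert i s hi ih =>
    rw [Finset.prod_insert hi, Finset.card_insert_of_notMem hi, mulPow,
      (hind.indepFun_finsetProd_of_notMem hX hi).symm.map_mul_eq_map_mconv_map (hX i)
        (by rw [show ∏ j ∈ s, X j = fun ω => ∏ j ∈ s, X j ω from funext fun ω => s.prod_apply ω X]
            exact s.measurable_prod fun i _ => hX i), hlaw, ih]

theorem iIndepFun_indepFun_prod_of_disjoint {Ω ι : Type*} [MeasurableSpace Ω] {P : Measure Ω}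
    {X : ι → Ω → ℝ} (hX : ∀ i, Measurable (X i)) (hind : iIndepFun X P) {s t : Finset ι}
    (hst : Disjoint s t) :
    IndepFun (∏ i ∈ s, X i) (∏ i ∈ t, X i) P := by
  have h := (hind.indepFun_finset s t hst hX).comp
    (φ := fun x : s → ℝ => ∏ i, x i) (ψ := fun x : t → ℝ => ∏ i, x i)
    (by fun_prop) (by fun_prop)
  convert h using 1
  · ext ω
    simp only [Finset.prod_apply, Function.comp]
    exact (Finset.prod_coe_sort s fun i => X i ω).symm
  · ext ω
    simp only [Finset.prod_apply, Function.comp]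
    exact (Finset.prod_coe_sort t fun i => X i ω).symm

theorem card_powersetCard_filter_mem_le {n : ℕ} (m : ℕ) (i : Fin n) :
    ((Finset.powersetCard m (Finset.univ : Finset (Fin n))).filter fun e => i ∈ e).card
      ≤ (n - 1).choose (m - 1) := by
  have h : (Finset.powersetCard (m - 1) (Finset.univ.erase i)).card = (n - 1).choose (m - 1) := by
    rw [Finset.card_powersetCard, Finset.card_erase_of_mem (Finset.mem_univ i), Finset.card_univ,
      Fintype.card_fin]
  rw [← h]
  refine Finset.card_le_card_of_injOn (fun e => e.erase i) (fun e he => ?_) ?_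
  · simp only [Finset.mem_coe, Finset.mem_filter, Finset.mem_powersetCard] at he ⊢
    exact ⟨Finset.erase_subset_erase i he.1.1, by rw [Finset.card_erase_of_mem he.2, he.1.2]⟩
  · intro e he e' he' hee
    simp only [Finset.mem_coe, Finset.mem_filter] at he he'
    rw [← Finset.insert_erase he.2, ← Finset.insert_erase he'.2]
    exact congrArg _ hee

/-- Few pairs of `m`-subsets intersect. -/
theorem mul_sum_card_filter_not_disjoint_le {n m : ℕ} (hn : 0 < n) (hm : 0 < m) :
    n * ∑ e ∈ Finset.powersetCard m (Finset.univ : Finset (Fin n)),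
      ((Finset.powersetCard m (Finset.univ : Finset (Fin n))).filter
        fun e' => ¬ Disjoint e e').card ≤ m ^ 2 * n.choose m ^ 2 := by
  classical
  have h1 : ∀ e ∈ Finset.powersetCard m (Finset.univ : Finset (Fin n)),
      ((Finset.powersetCard m (Finset.univ : Finset (Fin n))).filter
        fun e' => ¬ Disjoint e e').card ≤ m * (n - 1).choose (m - 1) := by
    intro e he
    -- Union bound over the `m` vertices of `e`, one of which must lie in `e'`.
    have hsub : ((Finset.powersetCard m (Finset.univ : Finset (Fin n))).filter
        fun e' => ¬ Disjoint e e') ⊆ e.biUnion fun i =>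
          (Finset.powersetCard m (Finset.univ : Finset (Fin n))).filter fun e' => i ∈ e' := by
      intro e' he'
      rw [Finset.mem_filter, Finset.not_disjoint_iff] at he'
      obtain ⟨h, i, hi, hi'⟩ := he'
      exact Finset.mem_biUnion.2 ⟨i, hi, Finset.mem_filter.2 ⟨h, hi'⟩⟩
    refine (Finset.card_le_card hsub).trans ?_
    rw [← (Finset.mem_powersetCard.1 he).2]
    refine Finset.card_biUnion_le_card_mul _ _ _ fun i _ => ?_
    rw [(Finset.mem_powersetCard.1 he).2]
    exact card_powersetCard_filter_mem_le m i
  have h2 := Finset.sum_le_card_nsmul _ _ _ h1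
  rw [Finset.card_powersetCard, Finset.card_univ, Fintype.card_fin, smul_eq_mul] at h2
  have h3 : n * (n - 1).choose (m - 1) = n.choose m * m := by
    have := Nat.add_one_mul_choose_eq (n - 1) (m - 1)
    rwa [Nat.sub_add_cancel hn, Nat.sub_add_cancel hm] at this
  calc _ ≤ n * (n.choose m * (m * (n - 1).choose (m - 1))) := Nat.mul_le_mul_left _ h2
    _ = n.choose m * m * (n * (n - 1).choose (m - 1)) := by ring
    _ = _ := by rw [h3]; ring

/-! ### First and second moments of the number of hyperedges. -/

namespace RandomHypergraph

variable {ν : Measure ℝ} {m n : ℕ} (G : RandomHypergraph.{u} ν m n)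

/-- The product of the weights of the vertices in `e`. -/
def weightProd (e : Finset (Fin n)) : G.Ω → ℝ := ∏ i ∈ e, fun ω => G.weight ω i

theorem weightProd_apply (e : Finset (Fin n)) (ω : G.Ω) :
    G.weightProd e ω = ∏ i ∈ e, G.weight ω i := by
  simp [weightProd]

theorem measurable_weight_apply (i : Fin n) : Measurable fun ω => G.weight ω i :=
  (measurable_pi_apply i).comp G.measurable_weight

theorem measurable_weightProd (e : Finset (Fin n)) : Measurable (G.weightProd e) := by
  rw [show G.weightProd e = fun ω => ∏ i ∈ e, G.weight ω i from funext (G.weightProd_apply e)]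
  exact e.measurable_prod fun i _ => G.measurable_weight_apply i

theorem map_weightProd (e : Finset (Fin n)) :
    Measure.map (G.weightProd e) G.P = mulPow ν e.card :=
  map_finset_prod_eq_mulPow G.measurable_weight_apply G.map_weight G.indep_weight e

theorem indepFun_weightProd {e e' : Finset (Fin n)} (h : Disjoint e e') :
    IndepFun (G.weightProd e) (G.weightProd e') G.P :=
  iIndepFun_indepFun_prod_of_disjoint G.measurable_weight_apply G.indep_weight h

/-- Weights are almost surely nonnegative, so the absolute values in `sat` are harmless. -/
theorem edgeProb_ae_eq (hn : 0 < n) (hν : ∀ᵐ x ∂ν, 0 ≤ x) (e : Finset (Fin n)) :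
    (fun ω => edgeProb (G.weight ω) e) =ᵐ[G.P] fun ω => sat ((n : ℝ)⁻¹ * G.weightProd e ω) := by
  have h := ae_nonneg_mulPow hν e.card
  rw [← G.map_weightProd e, ae_map_iff (G.measurable_weightProd e).aemeasurable
    measurableSet_Ici] at h
  have hn' : (0 : ℝ) < n := by exact_mod_cast hn
  filter_upwards [h] with ω hω
  rw [edgeProb, ← G.weightProd_apply, sat, abs_of_nonneg (by positivity)]
  have : (n : ℝ) + G.weightProd e ω ≠ 0 := by positivity
  field_simp

theorem measurable_sat_weightProd (e : Finset (Fin n)) :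
    Measurable fun ω => sat ((n : ℝ)⁻¹ * G.weightProd e ω) :=
  continuous_sat.measurable.comp ((G.measurable_weightProd e).const_mul _)

theorem integral_sat_weightProd (e : Finset (Fin n)) :
    ∫ ω, sat ((n : ℝ)⁻¹ * G.weightProd e ω) ∂G.P = meanSat ν e.card (n : ℝ)⁻¹ := by
  rw [meanSat, ← G.map_weightProd e, integral_map (G.measurable_weightProd e).aemeasurable
    (measurable_sat_const_mul _).aestronglyMeasurable]

theorem integral_sat_weightProd_sq (e : Finset (Fin n)) :
    ∫ ω, sat ((n : ℝ)⁻¹ * G.weightProd e ω) ^ 2 ∂G.P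
      = ∫ x, sat ((n : ℝ)⁻¹ * x) ^ 2 ∂mulPow ν e.card := by
  rw [← G.map_weightProd e, integral_map (G.measurable_weightProd e).aemeasurable
    ((measurable_sat_const_mul _).pow_const 2).aestronglyMeasurable]

theorem comap_weight_le : MeasurableSpace.comap G.weight inferInstance ≤ G.measurableSpace :=
  G.measurable_weight.comap_le

theorem measureReal_edge (hn : 0 < n) (hν : ∀ᵐ x ∂ν, 0 ≤ x) {e : Finset (Fin n)}
    (he : e.card = m) : G.P.real {ω | e ∈ G.edges ω} = meanSat ν m (n : ℝ)⁻¹ := by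
  have h := G.integral_sat_weightProd e
  rw [he] at h
  rw [← h, ← integral_congr_ae (G.edgeProb_ae_eq hn hν e),
    ← integral_congr_ae (G.condProb_edge e he), integral_condExp G.comap_weight_le]
  exact (integral_indicator_one (G.measurableSet_edge e)).symm

theorem measureReal_edge_inter (hn : 0 < n) (hν : ∀ᵐ x ∂ν, 0 ≤ x) {e e' : Finset (Fin n)}
    (he : e.card = m) (he' : e'.card = m) (hne : e ≠ e') :
    G.P.real ({ω | e ∈ G.edges ω} ∩ {ω | e' ∈ G.edges ω})
      = ∫ ω, sat ((n : ℝ)⁻¹ * G.weightProd e ω) * sat ((n : ℝ)⁻¹ * G.weightProd e' ω) ∂G.P := by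
  -- The product over this finset has two factors only because `e ≠ e'`.
  have h := G.condIndep_edge {e, e'} (by simp [he, he'])
  have h2 : ∀ᵐ ω ∂G.P, ∏ e ∈ {e, e'},
        (G.P⟦{ω' | e ∈ G.edges ω'} | MeasurableSpace.comap G.weight inferInstance⟧) ω
      = sat ((n : ℝ)⁻¹ * G.weightProd e ω) * sat ((n : ℝ)⁻¹ * G.weightProd e' ω) := by
    filter_upwards [G.condProb_edge e he, G.condProb_edge e' he', G.edgeProb_ae_eq hn hν e,
      G.edgeProb_ae_eq hn hν e'] with ω h1 h2 h3 h4
    rw [Finset.prod_pair hne, h1, h2, h3, h4]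
  rw [← integral_congr_ae h2, ← integral_congr_ae h, integral_condExp G.comap_weight_le]
  have e1 : (⋂ f ∈ ({e, e'} : Finset (Finset (Fin n))), {ω | f ∈ G.edges ω})
      = {ω | e ∈ G.edges ω} ∩ {ω | e' ∈ G.edges ω} := by
    simp [Set.iInter_iInter_eq_or_left]
  rw [e1]
  exact (integral_indicator_one ((G.measurableSet_edge e).inter (G.measurableSet_edge e'))).symm

/-- Disjoint edges involve independent weight products, so conditional independence becomes
unconditional. -/
theorem measureReal_edge_inter_of_disjoint (hn : 0 < n) (hν : ∀ᵐ x ∂ν, 0 ≤ x)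
    {e e' : Finset (Fin n)} (he : e.card = m) (he' : e'.card = m) (hne : e ≠ e')
    (hd : Disjoint e e') :
    G.P.real ({ω | e ∈ G.edges ω} ∩ {ω | e' ∈ G.edges ω}) = meanSat ν m (n : ℝ)⁻¹ ^ 2 := by
  have hs := measurable_sat_const_mul (n : ℝ)⁻¹
  rw [G.measureReal_edge_inter hn hν he he' hne]
  have h := ((G.indepFun_weightProd hd).comp hs hs).integral_fun_mul_eq_mul_integral
    (G.measurable_sat_weightProd e).aestronglyMeasurable
    (G.measurable_sat_weightProd e').aestronglyMeasurable
  simp only [Function.comp] at h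
  rw [h, G.integral_sat_weightProd, G.integral_sat_weightProd, he, he', sq]

/-- The bound `a b ≤ (a² + b²) / 2` removes any dependence on the size of the overlap. -/
theorem measureReal_edge_inter_le (hn : 0 < n) (hν : ∀ᵐ x ∂ν, 0 ≤ x)
    {e e' : Finset (Fin n)} (he : e.card = m) (he' : e'.card = m) (hne : e ≠ e') :
    G.P.real ({ω | e ∈ G.edges ω} ∩ {ω | e' ∈ G.edges ω})
      ≤ ∫ x, sat ((n : ℝ)⁻¹ * x) ^ 2 ∂mulPow ν m := by
  have hi : ∀ e, Integrable (fun ω => sat ((n : ℝ)⁻¹ * G.weightProd e ω) ^ 2) G.P := fun e =>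
    Integrable.of_bound ((G.measurable_sat_weightProd e).pow_const 2).aestronglyMeasurable 1
      (Eventually.of_forall fun ω => by
        rw [norm_pow]; exact pow_le_one₀ (norm_nonneg _) (norm_sat_le_one _))
  have hi2 : Integrable (fun ω => sat ((n : ℝ)⁻¹ * G.weightProd e ω)
      * sat ((n : ℝ)⁻¹ * G.weightProd e' ω)) G.P :=
    Integrable.of_bound ((G.measurable_sat_weightProd e).mul
      (G.measurable_sat_weightProd e')).aestronglyMeasurable 1
      (Eventually.of_forall fun ω => by
        rw [norm_mul]
        exact mul_le_one₀ (norm_sat_le_one _) (norm_nonneg _) (norm_sat_le_one _))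
  rw [G.measureReal_edge_inter hn hν he he' hne]
  refine (integral_mono hi2 (((hi e).add (hi e')).div_const 2) fun ω => ?_).trans (le_of_eq ?_)
  · have := two_mul_le_add_sq (sat ((n : ℝ)⁻¹ * G.weightProd e ω))
      (sat ((n : ℝ)⁻¹ * G.weightProd e' ω))
    simp only [Pi.add_apply]
    linarith
  · simp only [Pi.add_apply]
    rw [integral_div, integral_add (hi e) (hi e'), G.integral_sat_weightProd_sq,
      G.integral_sat_weightProd_sq, he, he']
    ring

theorem numEdges_eq_sum (ω : G.Ω) : (G.numEdges ω : ℝ)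
    = ∑ e ∈ Finset.powersetCard m Finset.univ, {ω | e ∈ G.edges ω}.indicator (1 : G.Ω → ℝ) ω := by
  classical
  have h : G.edges ω = (Finset.powersetCard m Finset.univ).filter fun e => e ∈ G.edges ω := by
    ext e
    simp only [Finset.mem_filter, Finset.mem_powersetCard, Finset.subset_univ, true_and]
    exact ⟨fun h => ⟨G.uniform ω e h, h⟩, fun h => h.2⟩
  rw [numEdges, h, Finset.card_filter]
  push_cast
  exact Finset.sum_congr rfl fun e _ => by simp [Set.indicator_apply]

theorem integrable_edge_indicator {s : Set G.Ω} (hs : MeasurableSet s) :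
    Integrable (s.indicator (1 : G.Ω → ℝ)) G.P :=
  (integrable_const (1 : ℝ)).indicator hs

theorem integrable_numEdges : Integrable (fun ω => (G.numEdges ω : ℝ)) G.P := by
  simp only [numEdges_eq_sum]
  exact integrable_finsetSum _ fun e _ => G.integrable_edge_indicator (G.measurableSet_edge e)

theorem integral_numEdges (hn : 0 < n) (hν : ∀ᵐ x ∂ν, 0 ≤ x) :
    ∫ ω, (G.numEdges ω : ℝ) ∂G.P = n.choose m * meanSat ν m (n : ℝ)⁻¹ := by
  simp only [numEdges_eq_sum]
  rw [integral_finsetSum _ fun e _ => G.integrable_edge_indicator (G.measurableSet_edge e)]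
  have h : ∀ e ∈ Finset.powersetCard m (Finset.univ : Finset (Fin n)),
      ∫ ω, {ω | e ∈ G.edges ω}.indicator (1 : G.Ω → ℝ) ω ∂G.P = meanSat ν m (n : ℝ)⁻¹ :=
    fun e he => by
      rw [integral_indicator_one (G.measurableSet_edge e),
        G.measureReal_edge hn hν (Finset.mem_powersetCard.1 he).2]
  rw [Finset.sum_congr rfl h, Finset.sum_const, Finset.card_powersetCard, Finset.card_univ,
    Fintype.card_fin, nsmul_eq_mul]

theorem numEdges_sq_eq_sum (ω : G.Ω) : (G.numEdges ω : ℝ) ^ 2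
    = ∑ e ∈ Finset.powersetCard m Finset.univ, ∑ e' ∈ Finset.powersetCard m Finset.univ,
      ({ω | e ∈ G.edges ω} ∩ {ω | e' ∈ G.edges ω}).indicator (1 : G.Ω → ℝ) ω := by
  rw [sq, numEdges_eq_sum, Finset.sum_mul_sum]
  refine Finset.sum_congr rfl fun e _ => Finset.sum_congr rfl fun e' _ => ?_
  rw [Set.inter_indicator_one, Pi.mul_apply]

theorem integrable_numEdges_sq : Integrable (fun ω => (G.numEdges ω : ℝ) ^ 2) G.P := by
  simp only [numEdges_sq_eq_sum]
  exact integrable_finsetSum _ fun e _ => integrable_finsetSum _ fun e' _ =>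
    G.integrable_edge_indicator ((G.measurableSet_edge e).inter (G.measurableSet_edge e'))

theorem integral_numEdges_sq_le [IsProbabilityMeasure ν] (hn : 0 < n) (hm : 0 < m)
    (hν : ∀ᵐ x ∂ν, 0 ≤ x) :
    ∫ ω, (G.numEdges ω : ℝ) ^ 2 ∂G.P ≤ n.choose m * meanSat ν m (n : ℝ)⁻¹
      + (n.choose m * meanSat ν m (n : ℝ)⁻¹) ^ 2
      + m ^ 2 * (n.choose m) ^ 2 / n * ∫ x, sat ((n : ℝ)⁻¹ * x) ^ 2 ∂mulPow ν m := by
  classical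
  set p := meanSat ν m (n : ℝ)⁻¹ with hp
  set r := ∫ x, sat ((n : ℝ)⁻¹ * x) ^ 2 ∂mulPow ν m with hr
  have hr0 : 0 ≤ r := integral_nonneg fun _ => sq_nonneg _
  have hn' : (0 : ℝ) < n := by exact_mod_cast hn
  have hI : ∀ e e', Integrable
      (({ω | e ∈ G.edges ω} ∩ {ω | e' ∈ G.edges ω}).indicator (1 : G.Ω → ℝ)) G.P := fun e e' =>
    G.integrable_edge_indicator ((G.measurableSet_edge e).inter (G.measurableSet_edge e'))
  simp only [numEdges_sq_eq_sum]
  rw [integral_finsetSum _ fun e _ => integrable_finsetSum _ fun e' _ => hI e e']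
  set S := Finset.powersetCard m (Finset.univ : Finset (Fin n)) with hS
  have hcard : (S.card : ℝ) = n.choose m := by
    rw [hS, Finset.card_powersetCard, Finset.card_univ, Fintype.card_fin]
  -- One additive bound for all pairs: `p` pays for the diagonal, `p ^ 2` for disjoint pairs, `r`
  -- for intersecting ones; superfluous terms are nonnegative.
  have hb : ∀ e ∈ S, ∀ e' ∈ S, ∫ ω, ({ω | e ∈ G.edges ω} ∩ {ω | e' ∈ G.edges ω}).indicator
      (1 : G.Ω → ℝ) ω ∂G.P
        ≤ (if e = e' then p else 0) + p ^ 2 + (if ¬ Disjoint e e' then r else 0) := by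
    intro e he e' he'
    rw [integral_indicator_one ((G.measurableSet_edge e).inter (G.measurableSet_edge e'))]
    have he := (Finset.mem_powersetCard.1 he).2
    have he' := (Finset.mem_powersetCard.1 he').2
    by_cases h : e = e'
    · subst h
      rw [if_pos rfl, Set.inter_self, G.measureReal_edge hn hν he]
      have : 0 ≤ if ¬ Disjoint e e then r else 0 := by split_ifs <;> simp [hr0]
      nlinarith [sq_nonneg p]
    · rw [if_neg h]
      by_cases hd : Disjoint e e'
      · rw [G.measureReal_edge_inter_of_disjoint hn hν he he' h hd]
        simp [hd, hp]
      · rw [if_pos hd]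
        have := G.measureReal_edge_inter_le hn hν he he' h
        nlinarith [sq_nonneg p]
  have hsum : ∑ e ∈ S, ∑ e' ∈ S, ((if e = e' then p else 0) + p ^ 2
      + (if ¬ Disjoint e e' then r else 0)) = n.choose m * p + (n.choose m * p) ^ 2
        + ((∑ e ∈ S, (S.filter fun e' => ¬ Disjoint e e').card : ℕ) : ℝ) * r := by
    simp only [Finset.sum_add_distrib, Finset.sum_const, nsmul_eq_mul, hcard,
      ← Finset.sum_filter, Nat.cast_sum, Finset.sum_mul]
    congr 2
    · rw [Finset.sum_congr rfl fun e he => by rw [Finset.filter_eq, if_pos he,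
        Finset.card_singleton, Nat.cast_one, one_mul], Finset.sum_const, nsmul_eq_mul, hcard]
    · ring
  have hcount : ((∑ e ∈ S, (S.filter fun e' => ¬ Disjoint e e').card : ℕ) : ℝ)
      ≤ m ^ 2 * (n.choose m) ^ 2 / n := by
    rw [le_div_iff₀ hn', mul_comm]
    exact_mod_cast mul_sum_card_filter_not_disjoint_le hn hm
  calc _ = ∑ e ∈ S, ∑ e' ∈ S, ∫ ω, ({ω | e ∈ G.edges ω} ∩ {ω | e' ∈ G.edges ω}).indicator
          (1 : G.Ω → ℝ) ω ∂G.P :=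
        Finset.sum_congr rfl fun e _ => integral_finsetSum _ fun e' _ => hI e e'
    _ ≤ _ := Finset.sum_le_sum fun e he => Finset.sum_le_sum fun e' he' => hb e he e' he'
    _ = _ := hsum
    _ ≤ _ := by gcongr

end RandomHypergraph

/-! ### The second moment method. -/

/-- Chebyshev's inequality centred at `a n` rather than at the mean. -/
theorem numEdgesAsymp_of_tendsto {ν : Measure ℝ} [IsProbabilityMeasure ν]
    (hν : ∀ᵐ x ∂ν, 0 ≤ x) {m : ℕ} (hm : 0 < m)
    (G : ∀ n : ℕ, RandomHypergraph.{u} ν m n) {a : ℕ → ℝ} (ha : Tendsto a atTop atTop)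
    (h1 : Tendsto (fun n : ℕ => n.choose m * meanSat ν m (n : ℝ)⁻¹ / a n) atTop (𝓝 1))
    (h2 : Tendsto (fun n : ℕ => (n.choose m : ℝ) ^ 2 / n
      * (∫ x, sat ((n : ℝ)⁻¹ * x) ^ 2 ∂mulPow ν m) / a n ^ 2) atTop (𝓝 0)) :
    NumEdgesAsymp G a := by
  refine ⟨fun n ω => (G n).numEdges ω / a n - 1, ?_, fun ε hε => ?_⟩
  · filter_upwards [ha.eventually_gt_atTop 0] with n hn ω
    field_simp
    ring
  -- The upper bound for the mean of `(numEdges / a n - 1) ^ 2`; its numerator tends to `0 + 1 + 0 -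
  -- 2 + 1 = 0`.
  have hlim : Tendsto (fun n : ℕ =>
      (n.choose m * meanSat ν m (n : ℝ)⁻¹ / a n * (a n)⁻¹
        + (n.choose m * meanSat ν m (n : ℝ)⁻¹ / a n) ^ 2
        + m ^ 2 * ((n.choose m : ℝ) ^ 2 / n
          * (∫ x, sat ((n : ℝ)⁻¹ * x) ^ 2 ∂mulPow ν m) / a n ^ 2)
        - 2 * (n.choose m * meanSat ν m (n : ℝ)⁻¹ / a n) + 1) / ε ^ 2) atTop (𝓝 0) := by
    have h := (((((h1.mul (tendsto_inv_atTop_zero.comp ha)).add (h1.pow 2)).add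
      (h2.const_mul ((m : ℝ) ^ 2))).sub (h1.const_mul 2)).add_const 1).div_const (ε ^ 2)
    norm_num at h
    exact h
  have hreal : Tendsto (fun n => (G n).P.real {ω | ε ≤ |(G n).numEdges ω / a n - 1|}) atTop
      (𝓝 0) := by
    refine squeeze_zero' (Eventually.of_forall fun n => measureReal_nonneg) ?_ hlim
    filter_upwards [ha.eventually_gt_atTop 0, eventually_gt_atTop 0] with n han hn
    have hi : Integrable (fun ω => ((G n).numEdges ω / a n - 1) ^ 2) (G n).P := by
      have := (((G n).integrable_numEdges_sq.div_const (a n ^ 2)).sub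
        (((G n).integrable_numEdges.div_const (a n)).const_mul 2)).add (integrable_const 1)
      refine this.congr (Eventually.of_forall fun ω => ?_)
      simp only [Pi.add_apply, Pi.sub_apply]
      ring
    have hval : ∫ ω, ((G n).numEdges ω / a n - 1) ^ 2 ∂(G n).P
        = (∫ ω, ((G n).numEdges ω : ℝ) ^ 2 ∂(G n).P) / a n ^ 2
          - 2 * ((∫ ω, ((G n).numEdges ω : ℝ) ∂(G n).P) / a n) + 1 := by
      have e : ∀ ω, ((G n).numEdges ω / a n - 1) ^ 2 = ((G n).numEdges ω : ℝ) ^ 2 / a n ^ 2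
          - 2 * ((G n).numEdges ω / a n) + 1 := fun ω => by ring
      simp only [e]
      have i1 := (G n).integrable_numEdges_sq.div_const (a n ^ 2)
      have i2 := ((G n).integrable_numEdges.div_const (a n)).const_mul 2
      have i3 : Integrable (fun ω => ((G n).numEdges ω : ℝ) ^ 2 / a n ^ 2
          - 2 * ((G n).numEdges ω / a n)) (G n).P := i1.sub i2
      rw [integral_add i3 (integrable_const _), integral_sub i1 i2, integral_div,
        integral_const_mul, integral_div]
      simp
    have hM := mul_meas_ge_le_integral_of_nonneg (Eventually.of_forall fun ω => sq_nonneg _) hi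
      (ε ^ 2)
    have hset : {ω | ε ≤ |((G n).numEdges ω : ℝ) / a n - 1|}
        ⊆ {ω | ε ^ 2 ≤ (((G n).numEdges ω : ℝ) / a n - 1) ^ 2} := by
      intro ω (hω : ε ≤ _)
      change ε ^ 2 ≤ _
      rw [← sq_abs (_ - 1)]
      exact pow_le_pow_left₀ hε.le hω 2
    rw [le_div_iff₀ (by positivity), mul_comm]
    refine (mul_le_mul_of_nonneg_left (measureReal_mono hset) (sq_nonneg ε)).trans (hM.trans ?_)
    rw [hval, (G n).integral_numEdges hn hν]
    have hsq := div_le_div_of_nonneg_right ((G n).integral_numEdges_sq_le hn hm hν)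
      (sq_nonneg (a n))
    refine (add_le_add_left (sub_le_sub_right hsq _) _).trans (le_of_eq ?_)
    field_simp
  have h := (ENNReal.continuous_ofReal.tendsto 0).comp hreal
  rw [ENNReal.ofReal_zero] at h
  exact h.congr fun n => ofReal_measureReal

theorem tendsto_choose_div_pow (m : ℕ) :
    Tendsto (fun n : ℕ => (n.choose m : ℝ) / (n : ℝ) ^ m) atTop (𝓝 (m.factorial : ℝ)⁻¹) := by
  have h := (isEquivalent_choose m)
  rw [Asymptotics.isEquivalent_iff_tendsto_one] at h
  · have h2 := h.mul_const (m.factorial : ℝ)⁻¹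
    rw [one_mul] at h2
    refine h2.congr' ?_
    filter_upwards [eventually_gt_atTop 0] with n hn
    have hn' : (0 : ℝ) < n := by exact_mod_cast hn
    have : (m.factorial : ℝ) ≠ 0 := by positivity
    simp only [Pi.div_apply]
    field_simp
  · filter_upwards [eventually_gt_atTop 0] with n hn
    have hn' : (0 : ℝ) < n := by exact_mod_cast hn
    positivity

/-- The second moment method with the edge probability normalised by `b n`. -/
theorem numEdgesAsymp_of_tendsto_meanSat {ν : Measure ℝ} [IsProbabilityMeasure ν]
    (hν : ∀ᵐ x ∂ν, 0 ≤ x) {m : ℕ} (hm : 0 < m)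
    (G : ∀ n : ℕ, RandomHypergraph.{u} ν m n) {b : ℕ → ℝ} {C : ℝ} (hC : 0 < C)
    (hb : ∀ᶠ n in atTop, 0 < b n)
    (hp : Tendsto (fun n : ℕ => meanSat ν m (n : ℝ)⁻¹ / b n) atTop (𝓝 C))
    (hab : Tendsto (fun n : ℕ => (n : ℝ) ^ m * b n) atTop atTop)
    (hr : Tendsto (fun n : ℕ => (∫ x, sat ((n : ℝ)⁻¹ * x) ^ 2 ∂mulPow ν m) / (n * b n ^ 2))
      atTop (𝓝 0)) :
    NumEdgesAsymp G fun n => C / m.factorial * ((n : ℝ) ^ m * b n) := by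
  have hf : (0 : ℝ) < m.factorial := by positivity
  have hch := tendsto_choose_div_pow m
  refine numEdgesAsymp_of_tendsto hν hm G (hab.const_mul_atTop (by positivity)) ?_ ?_
  · have h := (hch.mul hp).mul_const (C / m.factorial)⁻¹
    have e : (m.factorial : ℝ)⁻¹ * C * (C / m.factorial)⁻¹ = 1 := by field_simp
    rw [e] at h
    refine h.congr' ?_
    filter_upwards [hb, eventually_gt_atTop 0] with n hbn hn
    have hn' : (0 : ℝ) < n := by exact_mod_cast hn
    field_simp
  · have h := ((hch.pow 2).mul hr).mul_const ((C / m.factorial) ^ 2)⁻¹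
    rw [mul_zero, zero_mul] at h
    refine h.congr' ?_
    filter_upwards [hb, eventually_gt_atTop 0] with n hbn hn
    have hn' : (0 : ℝ) < n := by exact_mod_cast hn
    field_simp

/-- If the mean degree diverges, the edge probability alone controls the second moment. -/
theorem numEdgesAsymp_of_tendsto_meanSat_of_atTop {ν : Measure ℝ} [IsProbabilityMeasure ν]
    (hν : ∀ᵐ x ∂ν, 0 ≤ x) {m : ℕ} (hm : 0 < m)
    (G : ∀ n : ℕ, RandomHypergraph.{u} ν m n) {b : ℕ → ℝ} {C : ℝ} (hC : 0 < C)
    (hp : Tendsto (fun n : ℕ => meanSat ν m (n : ℝ)⁻¹ / b n) atTop (𝓝 C))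
    (hb : Tendsto (fun n : ℕ => (n : ℝ) * b n) atTop atTop) :
    NumEdgesAsymp G fun n => C / m.factorial * ((n : ℝ) ^ m * b n) := by
  have hb0 : ∀ᶠ n in atTop, 0 < b n := by
    filter_upwards [hb.eventually_gt_atTop 0, eventually_gt_atTop 0] with n h hn
    exact pos_of_mul_pos_right h (by positivity)
  refine numEdgesAsymp_of_tendsto_meanSat hν hm G hC hb0 hp ?_ ?_
  · refine tendsto_atTop_mono' _ ?_ hb
    filter_upwards [hb0, eventually_ge_atTop 1] with n h hn
    have hn' : (1 : ℝ) ≤ n := by exact_mod_cast hn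
    exact mul_le_mul_of_nonneg_right (le_self_pow₀ hn' hm.ne') h.le
  · have h := hp.mul (tendsto_inv_atTop_zero.comp hb)
    rw [mul_zero] at h
    refine squeeze_zero' (Eventually.of_forall fun n => ?_) ?_ h
    · exact div_nonneg (integral_nonneg fun _ => sq_nonneg _) (by positivity)
    · filter_upwards [hb0, eventually_gt_atTop 0] with n hbn hn
      have hn' : (0 : ℝ) < n := by exact_mod_cast hn
      have hle : ∫ x, sat ((n : ℝ)⁻¹ * x) ^ 2 ∂mulPow ν m ≤ meanSat ν m (n : ℝ)⁻¹ := by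
        refine integral_mono ?_ (integrable_sat_comp (measurable_const_mul _)) fun x =>
          pow_le_of_le_one (sat_nonneg _) (sat_le_one _) two_ne_zero
        exact Integrable.of_bound
          ((continuous_sat.comp (continuous_const_mul _)).pow 2).aestronglyMeasurable 1
          (Eventually.of_forall fun x => by
            rw [norm_pow]; exact pow_le_one₀ (norm_nonneg _) (norm_sat_le_one _))
      refine (div_le_div_of_nonneg_right hle (by positivity)).trans (le_of_eq ?_)
      simp only [Function.comp]
      field_simp

/-! ### The three regimes of the tail exponent. -/

theorem IsPowerLaw.numEdgesAsymp_of_one_lt {α lam x₀ : ℝ} (hα : 1 < α) (hlam : 0 < lam)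
    (hx₀ : 0 < x₀) {ν : Measure ℝ} (hν : IsPowerLaw α lam x₀ ν) {m : ℕ} (hm : 2 ≤ m)
    (G : ∀ n : ℕ, RandomHypergraph.{u} ν m n) :
    NumEdgesAsymp G fun n => (∫ x, x ∂ν) ^ m / (m.factorial : ℝ) * (n : ℝ) ^ (m - 1) := by
  have := hν.isProbabilityMeasure
  have hi := hν.integrable_id hα hlam hx₀
  have hn1 : ∀ᶠ n : ℕ in atTop, (0 : ℝ) < n := by
    filter_upwards [eventually_gt_atTop 0] with n hn
    exact_mod_cast hn
  have hpow : ∀ᶠ n : ℕ in atTop, (n : ℝ) ^ m * (n : ℝ)⁻¹ = (n : ℝ) ^ (m - 1) := by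
    filter_upwards [hn1] with n hn
    obtain ⟨k, rfl⟩ : ∃ k, m = k + 1 := ⟨m - 1, by omega⟩
    rw [pow_succ, mul_inv_cancel_right₀ hn.ne', Nat.add_sub_cancel]
  -- Now `n * b n = 1` does not diverge, so the separate estimate of the squared saturation is
  -- required.
  have h := numEdgesAsymp_of_tendsto_meanSat hν.nonneg (by omega) G (b := fun n => (n : ℝ)⁻¹)
    (pow_pos (hν.integral_id_pos hα hlam hx₀) m) (hn1.mono fun n hn => inv_pos.2 hn)
    ((tendsto_nat_mul_meanSat hν.nonneg hi m).congr fun n => by rw [div_inv_eq_mul, mul_comm])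
    (((tendsto_pow_atTop (by omega : m - 1 ≠ 0)).comp tendsto_natCast_atTop_atTop).congr'
      (hpow.mono fun n hn => hn.symm))
    ((tendsto_nat_mul_mean_sat_sq hi m).congr' (hn1.mono fun n hn => by field_simp))
  obtain ⟨δ, h1, h2⟩ := h
  refine ⟨δ, ?_, h2⟩
  filter_upwards [h1, hpow] with n hn hn' ω
  rw [hn ω, hn']

theorem tendsto_log_natCast_atTop : Tendsto (fun n : ℕ => Real.log n) atTop atTop :=
  Real.tendsto_log_atTop.comp tendsto_natCast_atTop_atTop

/-- One `m!` comes from the iterated integration, the other from the binomial coefficient; `n * b n`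
is `(log n) ^ m`, which diverges. -/
theorem IsPowerLaw.numEdgesAsymp_of_eq_one {lam x₀ : ℝ} (hlam : 0 < lam)
    (hx₀ : 0 < x₀) {ν : Measure ℝ} (hν : IsPowerLaw 1 lam x₀ ν) {m : ℕ} (hm : 0 < m)
    (G : ∀ n : ℕ, RandomHypergraph.{u} ν m n) :
    NumEdgesAsymp G fun n =>
      lam ^ m / m.factorial / m.factorial * (n : ℝ) ^ (m - 1) * Real.log n ^ m := by
  have := hν.isProbabilityMeasure
  have hn1 : ∀ᶠ n : ℕ in atTop, (0 : ℝ) < n := by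
    filter_upwards [eventually_gt_atTop 0] with n hn
    exact_mod_cast hn
  have h := numEdgesAsymp_of_tendsto_meanSat_of_atTop hν.nonneg hm G
    (b := fun n => (n : ℝ)⁻¹ * Real.log n ^ m) (C := lam ^ m / m.factorial) (by positivity)
    ((hν.tendsto_meanSat_of_eq_one hlam hx₀ m).congr' (hn1.mono fun n hn => by field_simp))
    (((tendsto_pow_atTop hm.ne').comp tendsto_log_natCast_atTop).congr'
      (hn1.mono fun n hn => by simp only [Function.comp]; field_simp))
  obtain ⟨δ, h1, h2⟩ := h
  refine ⟨δ, ?_, h2⟩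
  filter_upwards [h1, hn1] with n hn hn' ω
  obtain ⟨k, rfl⟩ : ∃ k, m = k + 1 := ⟨m - 1, by omega⟩
  rw [hn ω, Nat.add_sub_cancel, pow_succ (n : ℝ)]
  field_simp

theorem IsPowerLaw.numEdgesAsymp_of_lt_one {α lam x₀ : ℝ} (hα : 0 < α) (hα1 : α < 1)
    (hlam : 0 < lam) (hx₀ : 0 < x₀) {ν : Measure ℝ} (hν : IsPowerLaw α lam x₀ ν) {m : ℕ}
    (hm : 0 < m) (G : ∀ n : ℕ, RandomHypergraph.{u} ν m n) :
    NumEdgesAsymp G fun n => Real.pi * α ^ m * lam ^ m /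
      (Real.sin (α * Real.pi) * (m.factorial : ℝ) * ((m - 1).factorial : ℝ)) *
        (n : ℝ) ^ ((m : ℝ) - α) * Real.log n ^ (m - 1) := by
  have := hν.isProbabilityMeasure
  obtain ⟨k, rfl⟩ : ∃ k, m = k + 1 := ⟨m - 1, by omega⟩
  have hn1 : ∀ᶠ n : ℕ in atTop, (0 : ℝ) < n := by
    filter_upwards [eventually_gt_atTop 0] with n hn
    exact_mod_cast hn
  have hsin : 0 < Real.sin (α * Real.pi) :=
    Real.sin_pos_of_pos_of_lt_pi (by positivity) (by nlinarith [Real.pi_pos])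
  have hπ := Real.pi_pos
  have h := numEdgesAsymp_of_tendsto_meanSat_of_atTop hν.nonneg hm G
    (b := fun n => (n : ℝ) ^ (-α) * Real.log n ^ k)
    (C := (lam * α) ^ (k + 1) / k.factorial * (Real.pi / Real.sin (α * Real.pi)))
    (by positivity)
    ((hν.tendsto_meanSat_of_lt_one hα hα1 hlam hx₀ k).congr' (hn1.mono fun n hn => by
      beta_reduce
      rw [Real.rpow_neg hn.le]
      have := Real.rpow_pos_of_pos hn α
      field_simp))
    (by
      have h1 : Tendsto (fun n : ℕ => (n : ℝ) ^ (1 - α)) atTop atTop :=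
        (tendsto_rpow_atTop (by linarith)).comp tendsto_natCast_atTop_atTop
      -- Once `log n ≥ 1`, the logarithmic factor only helps and `n * b n ≥ n ^ (1 - α)`.
      refine tendsto_atTop_mono' _ ?_ h1
      filter_upwards [hn1, tendsto_log_natCast_atTop.eventually_ge_atTop 1] with n hn hl
      rw [← mul_assoc, sub_eq_add_neg, Real.rpow_add hn, Real.rpow_one]
      exact le_mul_of_one_le_right (by positivity) (one_le_pow₀ hl))
  obtain ⟨δ, h1, h2⟩ := h
  refine ⟨δ, ?_, h2⟩
  filter_upwards [h1, hn1] with n hn hn' ω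
  rw [hn ω, Nat.add_sub_cancel, sub_eq_add_neg, Real.rpow_add hn', Real.rpow_natCast,
    mul_pow]
  field_simp

theorem theorem1 {α lam x₀ : ℝ} (hα : 0 < α) (hlam : 0 < lam) (hx₀ : 0 < x₀)
    (ν : Measure ℝ) (hν : IsPowerLaw α lam x₀ ν) :
    (1 < α →
      Integrable (fun x : ℝ => x) ν ∧
      ∀ m : ℕ, 2 ≤ m → ∀ G : ∀ n : ℕ, RandomHypergraph.{u} ν m n,
        NumEdgesAsymp G (fun n =>
          (∫ x, x ∂ν) ^ m / (m.factorial : ℝ) * (n : ℝ) ^ (m - 1))) ∧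
    (α = 1 →
      ∀ m : ℕ, m = 2 ∨ m = 3 ∨ m = 4 → ∃ c : ℝ, 0 < c ∧
        ∀ G : ∀ n : ℕ, RandomHypergraph.{u} ν m n,
          NumEdgesAsymp G (fun n => c * (n : ℝ) ^ (m - 1) * Real.log n ^ m)) ∧
    (α < 1 →
      ∀ m : ℕ, m = 2 ∨ m = 3 ∨ m = 4 → ∀ G : ∀ n : ℕ, RandomHypergraph.{u} ν m n,
        NumEdgesAsymp G (fun n =>
          Real.pi * α ^ m * lam ^ m /
              (Real.sin (α * Real.pi) * (m.factorial : ℝ) * ((m - 1).factorial : ℝ)) *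
            (n : ℝ) ^ ((m : ℝ) - α) * Real.log n ^ (m - 1))) := by
  have hpos : ∀ {m : ℕ}, m = 2 ∨ m = 3 ∨ m = 4 → 0 < m := by omega
  refine ⟨fun h => ⟨hν.integrable_id h hlam hx₀, fun m hm G =>
    hν.numEdgesAsymp_of_one_lt h hlam hx₀ hm G⟩, fun h m hm => ?_, fun h m hm G =>
      hν.numEdgesAsymp_of_lt_one hα h hlam hx₀ (hpos hm) G⟩
  subst h
  exact ⟨lam ^ m / m.factorial / m.factorial, by positivity, fun G =>
    hν.numEdgesAsymp_of_eq_one hlam hx₀ (hpos hm) G⟩
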